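/- Throughout, $\log$ is the logarithm to base $2$, $\mathbb N_*=\{1,2,\dots\}$, and $\alpha>0$, $C>e^{2\alpha}$ are fixed. Let $\Lambda_{Ce^{-\alpha\cdot}}$ be the set of all stationary memoryless (i.i.d.) sources $\boldsymbol P$ on $\mathbb N_*$, i.e. probability distributions of i.i.d. sequences $(X_i)_{i\ge1}$ of positive integers, whose one-symbol marginal satisfies $P(k)\le Ce^{-\alpha k}$ for all $k\ge1$. Write $P^n$ for the law of $X_{1:n}=(X_1,\dots,X_n)$ under $\boldsymbol P$ and $H(P^n)=\mathbb E_{P^n}[-\log P^n(X_{1:n})]$ for its binary entropy. For $x_{1:n}\in\mathbb N_*^n$ put $m_0=0$ and $m_i=\max_{1\le k\le i}x_k$, let $n_i^j$ be the number of occurrences of $j$ among $x_1,\dots,x_i$, and define the censored string $\widetilde x_{1:n}$ by $\widetilde x_i=x_i$ if $x_i\le m_{i-1}$ and $\widetilde x_i=0$ otherwise. The censored-symbol coding probability is $$Q^n(\widetilde x_{1:n})=\prod_{i=0}^{n-1}Q_{i+1}(\widetilde x_{i+1}\mid x_{1:i}),$$ where $$Q_{i+1}(j\mid x_{1:i})=\frac{n_i^j+\frac12}{i+\frac{m_i+1}{2}}\quad(1\le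 j\le m_i),\qquad Q_{i+1}(0\mid x_{1:i})=\frac{\frac12}{i+\frac{m_i+1}{2}}.$$ **Proposition.** For every $n\ge0$ and every $\boldsymbol P\in\Lambda_{Ce^{-\alpha\cdot}}$ the random variables $\log P^n(X_{1:n})$ and $\log Q^n(\widetilde X_{1:n})$ are integrable under $P^n$; for every $n\ge 0$ the redundancies $\mathbb E_{P^n}\big[-\log Q^n(\widetilde X_{1:n})-H(P^n)\big]$ are bounded above over $\boldsymbol P\in\Lambda_{Ce^{-\alpha\cdot}}$; and, as $n\to\infty$, $$\sup_{\boldsymbol P\in\Lambda_{Ce^{-\alpha\cdot}}}\mathbb E_{P^n}\big[-\log Q^n(\widetilde X_{1:n})-H(P^n)\big]\;\le\;(1+o(1))\,\frac{1}{4\alpha\log e}\,\log^2 n ,$$ where the $o(1)$ term may depend on $C$ and $\alpha$ only (not on $\boldsymbol P$). -/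

import Mathlib

open MeasureTheory ProbabilityTheory Filter Topology

noncomputable section

namespace ACCode

/-- The alphabet of positive integers carries the discrete sigma-algebra. -/
instance : MeasurableSpace ℕ+ := ⊤

instance : DiscreteMeasurableSpace ℕ+ := ⟨fun _ => trivial⟩

/-! ### Sources on the alphabet of positive integers -/

/-- A stationary and memoryless source on the positive integers: a shift-invariant probability
measure on the infinite sequences of symbols, under which the symbols are independent.
The symbol `x i` is the `(i + 1)`-st symbol of the sequence. -/
structure IsStationaryMemoryless (P : Measure (ℕ → ℕ+)) : Prop where
  isProbabilityMeasure : IsProbabilityMeasure P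
  stationary : MeasurePreserving (fun (x : ℕ → ℕ+) (i : ℕ) => x (i + 1)) P P
  memoryless : iIndepFun (fun (i : ℕ) (x : ℕ → ℕ+) => x i) P

/-- The exponentially decreasing envelope class: the stationary memoryless sources whose
one-symbol marginal satisfies `P(k) ≤ C e ^ (-α k)` for every positive integer `k`. -/
def expEnvelopeClass (C α : ℝ) : Set (Measure (ℕ → ℕ+)) :=
  {P | IsStationaryMemoryless P ∧
    ∀ k : ℕ+, P.real {x | x 0 = k} ≤ C * Real.exp (-α * (k : ℝ))}

/-- The law `P^n` of the first `n` symbols. -/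
def marginal (P : Measure (ℕ → ℕ+)) (n : ℕ) : Measure (Fin n → ℕ+) :=
  P.map (fun (x : ℕ → ℕ+) (i : Fin n) => x i)

/-- The binary entropy `H(P^n) = E[-log₂ P^n(X_{1:n})]`. -/
def entropy (P : Measure (ℕ → ℕ+)) (n : ℕ) : ℝ :=
  ∫ x, -Real.logb 2 ((marginal P n).real {x}) ∂(marginal P n)

/-! ### The coding probability of the censored string

A string of length `n` is a function `x : Fin n → ℕ+`; the entry `x i` is the `(i + 1)`-st
symbol, so that the symbols preceding it are the first `i` symbols, those at places `k < i`. -/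

/-- The maximum `m_i` of the first `i` symbols, with `m_0 = 0`. -/
def runningMax {n : ℕ} (x : Fin n → ℕ+) (i : ℕ) : ℕ :=
  (Finset.univ.filter (fun k : Fin n => (k : ℕ) < i)).sup (fun k => (x k : ℕ))

/-- The number `n_i^j` of occurrences of the symbol `j` among the first `i` symbols. -/
def count {n : ℕ} (x : Fin n → ℕ+) (i j : ℕ) : ℕ :=
  (Finset.univ.filter (fun k : Fin n => (k : ℕ) < i ∧ (x k : ℕ) = j)).card

/-- The censored symbol: a symbol larger than all preceding ones is replaced by `0`. -/
def censored {n : ℕ} (x : Fin n → ℕ+) (i : Fin n) : ℕ :=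
  if (x i : ℕ) ≤ runningMax x i then (x i : ℕ) else 0

/-- The conditional coding probability, given the first `i` symbols of `x`, that the next
censored symbol is `j`. It is a probability on `{0, ..., m_i}`. -/
def condProb {n : ℕ} (x : Fin n → ℕ+) (i j : ℕ) : ℝ :=
  if j = 0 then (1 / 2) / ((i : ℝ) + ((runningMax x i : ℝ) + 1) / 2)
  else if j ≤ runningMax x i then
    ((count x i j : ℝ) + 1 / 2) / ((i : ℝ) + ((runningMax x i : ℝ) + 1) / 2)
  else 0

/-- The coding probability `Q^n` of the censored string obtained from `x`. -/
def codingProb {n : ℕ} (x : Fin n → ℕ+) : ℝ :=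
  ∏ i : Fin n, condProb x i (censored x i)

/-- The expected redundancy `E[-log₂ Q^n(X̃_{1:n}) - H(P^n)]` for the source `P`. -/
def redundancy (P : Measure (ℕ → ℕ+)) (n : ℕ) : ℝ :=
  ∫ x, (-Real.logb 2 (codingProb x) - entropy P n) ∂(marginal P n)

end ACCode

end

/-! The bound is pathwise before any expectation is taken. Grouped by symbol, the numerators of
`codingProb` are products of t + 1/2, so they give at least ∑ (N log N - N) over the multiplicities
N. The memoryless likelihood is at most the empirical one, with the same N log N terms. What remains
comes from the denominators: 1 + ∑ (m_i + 1)/(2i) nats (`pathwise_redundancy_le`). Under the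
envelope E m_i ≤ log i / α + O(1) (`integral_runningMax_le`), and ∑ log i / (2αi) ~ log² n / (4α).
All constants depend on C and α only, so the bound is uniform over the class
(`redundancy_mul_log_two_le`). -/

/-! ### Elementary sums of logarithms (natural logarithms until the final theorem). -/

theorem sum_log_add_half_ge (N : ℕ) :
    (N : ℝ) * Real.log N - N ≤ ∑ t ∈ Finset.range N, Real.log ((t : ℝ) + 1 / 2) := by
  induction N with
  | zero => simp
  | succ N ih =>
    rw [Finset.sum_range_succ]
    have hc : (0 : ℝ) < (N : ℝ) + 1 / 2 := by positivity
    -- By concavity log lies below its tangent at the midpoint, whose linear part integrates to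
    -- zero.
    have key : ∫ x in (N : ℝ)..(N + 1 : ℝ), Real.log x ≤
        ∫ x in (N : ℝ)..(N + 1 : ℝ),
          (Real.log ((N : ℝ) + 1 / 2) + (x - ((N : ℝ) + 1 / 2)) / ((N : ℝ) + 1 / 2)) := by
      apply intervalIntegral.integral_mono_on_of_le_Ioo (by linarith)
      · exact intervalIntegral.intervalIntegrable_log'
      · exact Continuous.intervalIntegrable (by fun_prop) _ _
      · intro x hx
        have hx0 : 0 < x := lt_of_le_of_lt (Nat.cast_nonneg N) hx.1
        have h := Real.log_le_sub_one_of_pos (div_pos hx0 hc)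
        rw [Real.log_div hx0.ne' hc.ne'] at h
        rw [sub_div, div_self hc.ne']
        linarith
    have hr : ∫ x in (N : ℝ)..(N + 1 : ℝ),
          (Real.log ((N : ℝ) + 1 / 2) + (x - ((N : ℝ) + 1 / 2)) / ((N : ℝ) + 1 / 2)) =
          Real.log ((N : ℝ) + 1 / 2) := by
      rw [intervalIntegral.integral_add (by simp)
        (Continuous.intervalIntegrable (by fun_prop) _ _), intervalIntegral.integral_div,
        intervalIntegral.integral_sub (Continuous.intervalIntegrable (by fun_prop) _ _) (by simp)]
      simp only [intervalIntegral.integral_const, integral_id, smul_eq_mul]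
      have : ((((N : ℝ) + 1) ^ 2 - (N : ℝ) ^ 2) / 2 - ((N : ℝ) + 1 - N) * (N + 1 / 2)) = 0 := by
        ring
      rw [this]
      simp
    rw [hr, integral_log] at key
    push_cast
    linarith

theorem inv_add_one_le_log_sub_log {n : ℝ} (hn : 0 < n) :
    1 / (n + 1) ≤ Real.log (n + 1) - Real.log n := by
  have h1 : 0 < n + 1 := by linarith
  have h := Real.one_sub_inv_le_log_of_pos (div_pos h1 hn)
  rw [Real.log_div h1.ne' hn.ne', inv_div] at h
  have : 1 - n / (n + 1) = 1 / (n + 1) := by field_simp; ring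
  linarith

theorem sum_log_le (n : ℕ) :
    ∑ i ∈ Finset.range n, Real.log (i : ℝ) ≤ (n : ℝ) * Real.log n - n + 1 := by
  induction n with
  | zero => simp
  | succ n ih =>
    rw [Finset.sum_range_succ]
    rcases Nat.eq_zero_or_pos n with rfl | hn
    · simp
    · have hn' : (0 : ℝ) < n := by exact_mod_cast hn
      have h := inv_add_one_le_log_sub_log hn'
      rw [div_le_iff₀ (by linarith)] at h
      push_cast
      nlinarith

theorem sum_inv_le (n : ℕ) : ∑ i ∈ Finset.range n, 1 / (i : ℝ) ≤ 2 * Real.log n := by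
  induction n with
  | zero => simp
  | succ n ih =>
    rw [Finset.sum_range_succ]
    rcases Nat.eq_zero_or_pos n with rfl | hn
    · simp
    · have hn' : (1 : ℝ) ≤ n := by exact_mod_cast hn
      have h := inv_add_one_le_log_sub_log (by linarith : (0 : ℝ) < n)
      have h2 : 1 / (n : ℝ) ≤ 2 * (1 / ((n : ℝ) + 1)) := by
        rw [mul_one_div, div_le_div_iff₀ (by linarith) (by linarith)]
        linarith
      push_cast
      linarith

/-- With d = log (n+1) - log n ≥ 1/(n+1), the right side grows by at least d log n + d/2. The d/2
pays for replacing 1/n by 1/(n+1), since log n / n ≤ 1/2. -/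
theorem sum_log_div_le (n : ℕ) :
    ∑ i ∈ Finset.range n, Real.log (i : ℝ) / i ≤ ((Real.log n) ^ 2 + Real.log n) / 2 := by
  induction n with
  | zero => simp
  | succ n ih =>
    rw [Finset.sum_range_succ]
    rcases Nat.eq_zero_or_pos n with rfl | hn
    · simp
    · have hn' : (1 : ℝ) ≤ n := by exact_mod_cast hn
      have hn0 : (0 : ℝ) < n := by linarith
      have h := inv_add_one_le_log_sub_log hn0
      have hL : 0 ≤ Real.log n := Real.log_nonneg hn'
      have hL2 : Real.log n ≤ n / 2 := by
        have h1 := Real.log_le_sub_one_of_pos (half_pos hn0)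
        rw [Real.log_div hn0.ne' two_ne_zero] at h1
        linarith [Real.log_two_lt_d9]
      have e : Real.log n / n =
          Real.log n * (1 / ((n : ℝ) + 1)) + (Real.log n / n) * (1 / ((n : ℝ) + 1)) := by
        field_simp
      have h3 : Real.log n / n ≤ 1 / 2 := by
        rw [div_le_iff₀ hn0]; linarith
      have h4 : 0 < 1 / ((n : ℝ) + 1) := by positivity
      push_cast
      set d := Real.log ((n : ℝ) + 1) - Real.log n with hd
      have hd' : Real.log ((n : ℝ) + 1) = Real.log n + d := by rw [hd]; ring
      rw [hd']
      nlinarith [mul_le_mul_of_nonneg_left h hL, mul_le_mul_of_nonneg_right h3 h4.le, sq_nonneg d]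

/-- Ranks in a finite ordered set run through 0, 1, 2, ...; applied to the places where one symbol
occurs. -/
theorem sum_card_filter_lt {ι M : Type*} [LinearOrder ι] [AddCommMonoid M] (s : Finset ι)
    (f : ℕ → M) :
    ∑ i ∈ s, f (s.filter (· < i)).card = ∑ t ∈ Finset.range s.card, f t := by
  refine Finset.induction_on_max s (by simp) fun a s ha ih => ?_
  have has : a ∉ s := fun h => lt_irrefl _ (ha a h)
  rw [Finset.sum_insert has, Finset.card_insert_of_notMem has, Finset.sum_range_succ, ← ih,
    add_comm]
  congr 1
  · refine Finset.sum_congr rfl fun i hi => ?_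
    rw [Finset.filter_insert, if_neg (not_lt.2 (ha i hi).le)]
  · rw [Finset.filter_insert, if_neg (lt_irrefl a), Finset.filter_true_of_mem ha]

namespace ACCode

/-! ### Pathwise bounds -/

/-- The conditional coding probability of the `(i + 1)`-st censored symbol, in the form common to
the censored and the uncensored case. -/
theorem condProb_censored {n : ℕ} (x : Fin n → ℕ+) (i : Fin n) :
    condProb x i (censored x i) =
      ((count x i (x i) : ℝ) + 1 / 2) / ((i : ℝ) + ((runningMax x i : ℝ) + 1) / 2) := by
  unfold censored condProb
  split_ifs with h1 h2 h3 h4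
  · exact absurd h2 (x i).pos.ne'
  · rfl
  -- A new strict maximum has not occurred before, so the weight 1/2 is its count plus 1/2.
  · have : count x i (x i) = 0 := by
      unfold count
      rw [Finset.card_eq_zero, Finset.filter_eq_empty_iff]
      rintro k - ⟨hk, hkx⟩
      refine h1 ?_
      rw [← hkx]
      exact Finset.le_sup (f := fun k => (x k : ℕ)) (by simp only [Finset.mem_filter, Finset.mem_univ, true_and]; exact hk)
    rw [this]
    simp
  all_goals exact absurd rfl h3

theorem condProb_censored_pos {n : ℕ} (x : Fin n → ℕ+) (i : Fin n) :
    0 < condProb x i (censored x i) := by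
  rw [condProb_censored]
  positivity

theorem condProb_censored_le_one {n : ℕ} (x : Fin n → ℕ+) (i : Fin n) :
    condProb x i (censored x i) ≤ 1 := by
  rw [condProb_censored, div_le_one (by positivity)]
  have h : count x i (x i) ≤ i := by
    unfold count
    calc _ ≤ (Finset.univ.filter (fun k : Fin n => (k : ℕ) < i)).card :=
          Finset.card_le_card fun k hk => by
            simp only [Finset.mem_filter, Finset.mem_univ, true_and] at hk ⊢
            exact hk.1
      _ = i := by rw [Fin.card_filter_val_lt, min_eq_right i.2.le]
  have h' : (count x i (x i) : ℝ) ≤ i := by exact_mod_cast h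
  have : (0 : ℝ) ≤ runningMax x i := Nat.cast_nonneg _
  linarith

theorem log_codingProb {n : ℕ} (x : Fin n → ℕ+) :
    Real.log (codingProb x) =
      ∑ i : Fin n, Real.log ((count x i (x i) : ℝ) + 1 / 2) -
        ∑ i : Fin n, Real.log ((i : ℝ) + ((runningMax x i : ℝ) + 1) / 2) := by
  unfold codingProb
  rw [Real.log_prod fun i _ => (condProb_censored_pos x i).ne', ← Finset.sum_sub_distrib]
  refine Finset.sum_congr rfl fun i _ => ?_
  rw [condProb_censored, Real.log_div (by positivity) (by positivity)]

theorem log_codingProb_nonpos {n : ℕ} (x : Fin n → ℕ+) : Real.log (codingProb x) ≤ 0 :=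
  Real.log_nonpos (Finset.prod_nonneg fun i _ => (condProb_censored_pos x i).le)
    (Finset.prod_le_one (fun i _ => (condProb_censored_pos x i).le)
      fun i _ => condProb_censored_le_one x i)

/-- A crude bound, used only for integrability. -/
theorem neg_log_codingProb_le {n : ℕ} (x : Fin n → ℕ+) :
    -Real.log (codingProb x) ≤ ∑ i : Fin n, (2 * (i : ℝ) + runningMax x i) := by
  rw [log_codingProb, neg_sub, ← Finset.sum_sub_distrib]
  refine Finset.sum_le_sum fun i _ => ?_
  rw [← Real.log_div (by positivity) (by positivity)]
  refine (Real.log_le_sub_one_of_pos (by positivity)).trans ?_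
  rw [sub_le_iff_le_add, div_le_iff₀ (by positivity)]
  have h1 : (0 : ℝ) ≤ count x i (x i) := Nat.cast_nonneg _
  have h2 : (0 : ℝ) ≤ runningMax x i := Nat.cast_nonneg _
  have h3 : (0 : ℝ) ≤ (i : ℕ) := Nat.cast_nonneg _
  nlinarith [mul_nonneg h1 h2, mul_nonneg h1 h3]

theorem sum_log_denominator_le {n : ℕ} (x : Fin n → ℕ+) :
    ∑ i : Fin n, Real.log ((i : ℝ) + ((runningMax x i : ℝ) + 1) / 2) ≤
      ∑ i : Fin n, Real.log (i : ℕ) + ∑ i : Fin n, ((runningMax x i : ℝ) + 1) / (2 * (i : ℕ)) := by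
  rw [← Finset.sum_add_distrib]
  refine Finset.sum_le_sum fun i _ => ?_
  rcases Nat.eq_zero_or_pos (i : ℕ) with hi | hi
  -- At i = 0 the left term is log (1/2), while both right terms are 0 by the conventions for log 0
  -- and division by 0.
  · have : runningMax x i = 0 := by simp [runningMax, hi]
    rw [this, hi]
    simpa using Real.log_nonneg (by norm_num : (1 : ℝ) ≤ 2)
  · have hi' : (0 : ℝ) < (i : ℕ) := by exact_mod_cast hi
    have h := Real.log_le_sub_one_of_pos
      (show 0 < ((i : ℝ) + ((runningMax x i : ℝ) + 1) / 2) / (i : ℕ) by positivity)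
    rw [Real.log_div (by positivity) hi'.ne', add_div _ _ ((i : ℕ) : ℝ), div_self hi'.ne',
      div_div] at h
    linarith

/-- The number of occurrences of the symbol `j` in the whole string. -/
def multiplicity {n : ℕ} (x : Fin n → ℕ+) (j : ℕ+) : ℕ :=
  (Finset.univ.filter (fun k : Fin n => x k = j)).card

theorem multiplicity_pos {n : ℕ} (x : Fin n → ℕ+) (i : Fin n) : 0 < multiplicity x (x i) :=
  Finset.card_pos.2 ⟨i, by simp⟩

theorem sum_log_multiplicity_le {n : ℕ} (x : Fin n → ℕ+) :
    ∑ i : Fin n, (Real.log (multiplicity x (x i)) - 1) ≤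
      ∑ i : Fin n, Real.log ((count x i (x i) : ℝ) + 1 / 2) := by
  rw [← Finset.sum_fiberwise_of_maps_to (s := Finset.univ) (t := Finset.univ.image x) (g := x)
      (by simp), ← Finset.sum_fiberwise_of_maps_to (s := Finset.univ) (t := Finset.univ.image x)
      (g := x) (f := fun i : Fin n => Real.log ((count x i (x i) : ℝ) + 1 / 2)) (by simp)]
  refine Finset.sum_le_sum fun j _ => ?_
  have h1 : ∑ i : Fin n with x i = j, (Real.log (multiplicity x (x i)) - 1) =
      multiplicity x j * Real.log (multiplicity x j) - multiplicity x j := by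
    rw [Finset.sum_congr rfl (g := fun _ => Real.log (multiplicity x j) - 1)
      (fun i hi => by rw [(Finset.mem_filter.1 hi).2]), Finset.sum_const, nsmul_eq_mul]
    change (multiplicity x j : ℝ) * _ = _
    ring
  have h2 : ∑ i : Fin n with x i = j, Real.log ((count x i (x i) : ℝ) + 1 / 2) =
      ∑ t ∈ Finset.range (multiplicity x j), Real.log ((t : ℝ) + 1 / 2) := by
    rw [multiplicity, ← sum_card_filter_lt]
    refine Finset.sum_congr rfl fun i hi => ?_
    rw [(Finset.mem_filter.1 hi).2, Finset.filter_filter, count]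
    simp only [PNat.coe_inj, Fin.val_fin_lt, and_comm]
  rw [h1, h2]
  exact sum_log_add_half_ge _

/-- The empirical distribution maximizes the likelihood. -/
theorem sum_log_le_sum_log_multiplicity {n : ℕ} (x : Fin n → ℕ+) (p : ℕ+ → ℝ)
    (hpos : ∀ i, 0 < p (x i)) (hsum : ∀ s : Finset ℕ+, ∑ j ∈ s, p j ≤ 1) :
    ∑ i : Fin n, Real.log (p (x i)) ≤
      ∑ i : Fin n, Real.log (multiplicity x (x i)) - n * Real.log n := by
  have hs : ∑ i : Fin n, p (x i) / multiplicity x (x i) ≤ 1 := by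
    rw [← Finset.sum_fiberwise_of_maps_to (s := Finset.univ) (t := Finset.univ.image x) (g := x)
      (by simp)]
    refine le_trans (Finset.sum_le_sum fun j hj => ?_) (hsum (Finset.univ.image x))
    rw [Finset.sum_congr rfl (g := fun _ => p j / multiplicity x j)
      (fun i hi => by rw [(Finset.mem_filter.1 hi).2]), Finset.sum_const, nsmul_eq_mul]
    obtain ⟨i, -, rfl⟩ := Finset.mem_image.1 hj
    have : (0 : ℝ) < multiplicity x (x i) := by exact_mod_cast multiplicity_pos x i
    change (multiplicity x (x i) : ℝ) * _ ≤ _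
    rw [mul_div_cancel₀ _ this.ne']
  -- Gibbs' inequality: log u ≤ u - 1 at u = n p / N, whose sum over i is at most n by `hs`.
  have h : ∀ i : Fin n, Real.log (p (x i)) - Real.log (multiplicity x (x i)) + Real.log n ≤
      n * (p (x i) / multiplicity x (x i)) - 1 := by
    intro i
    have hm : (0 : ℝ) < multiplicity x (x i) := by exact_mod_cast multiplicity_pos x i
    have hn : (0 : ℝ) < n := by exact_mod_cast i.pos
    have hq := div_pos (hpos i) hm
    rw [← Real.log_div (hpos i).ne' hm.ne', add_comm, ← Real.log_mul hn.ne' hq.ne']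
    exact Real.log_le_sub_one_of_pos (mul_pos hn hq)
  have := Finset.sum_le_sum fun i (_ : i ∈ Finset.univ) => h i
  simp only [Finset.sum_add_distrib, Finset.sum_sub_distrib, ← Finset.mul_sum, Finset.sum_const,
    Finset.card_univ, Fintype.card_fin, nsmul_eq_mul, mul_one] at this
  have hn : (0 : ℝ) ≤ n := Nat.cast_nonneg n
  nlinarith [mul_le_mul_of_nonneg_left hs hn]

/-- The pathwise redundancy (in nats) is controlled by the running maxima. -/
theorem pathwise_redundancy_le {n : ℕ} (x : Fin n → ℕ+) (p : ℕ+ → ℝ)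
    (hpos : ∀ i, 0 < p (x i)) (hsum : ∀ s : Finset ℕ+, ∑ j ∈ s, p j ≤ 1) :
    -Real.log (codingProb x) + ∑ i : Fin n, Real.log (p (x i)) ≤
      1 + ∑ i : Fin n, ((runningMax x i : ℝ) + 1) / (2 * (i : ℕ)) := by
  have h1 := sum_log_denominator_le x
  have h2 := sum_log_multiplicity_le x
  have h3 := sum_log_le_sum_log_multiplicity x p hpos hsum
  have h4 := sum_log_le n
  rw [Fin.sum_univ_eq_sum_range (fun i => Real.log (i : ℝ)) n] at h1
  rw [Finset.sum_sub_distrib] at h2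
  simp only [Finset.sum_const, Finset.card_univ, Fintype.card_fin, nsmul_eq_mul, mul_one] at h2
  rw [log_codingProb]
  linarith

/-! ### The law of the symbols -/

/-- The one-symbol marginal of a source. -/
noncomputable def symbolLaw (P : Measure (ℕ → ℕ+)) : Measure ℕ+ := P.map (fun x => x 0)

section SymbolLaw

variable {C α : ℝ} {P : Measure (ℕ → ℕ+)}

theorem isProbabilityMeasure_symbolLaw (h : IsStationaryMemoryless P) :
    IsProbabilityMeasure (symbolLaw P) := by
  have := h.isProbabilityMeasure
  exact Measure.isProbabilityMeasure_map (measurable_pi_apply 0).aemeasurable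

theorem map_apply_eq_symbolLaw (h : IsStationaryMemoryless P) (i : ℕ) :
    P.map (fun x => x i) = symbolLaw P := by
  induction i with
  | zero => rfl
  | succ i ih =>
    rw [← ih]
    nth_rw 2 [← h.stationary.map_eq]
    rw [Measure.map_map (measurable_pi_apply i) h.stationary.measurable]
    rfl

theorem marginal_eq_pi (h : IsStationaryMemoryless P) (n : ℕ) :
    marginal P n = Measure.pi (fun _ : Fin n => symbolLaw P) := by
  have := h.isProbabilityMeasure
  have hi := h.memoryless.precomp (g := fun i : Fin n => (i : ℕ)) Fin.val_injective
  rw [iIndepFun_iff_map_fun_eq_pi_map fun i => (measurable_pi_apply _).aemeasurable] at hi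
  simp only [map_apply_eq_symbolLaw h] at hi
  exact hi

theorem marginal_real_singleton (h : IsStationaryMemoryless P) {n : ℕ} (x : Fin n → ℕ+) :
    (marginal P n).real {x} = ∏ i, (symbolLaw P).real {x i} := by
  have := isProbabilityMeasure_symbolLaw h
  rw [marginal_eq_pi h, Measure.real, Measure.pi_singleton, ENNReal.toReal_prod]
  rfl

theorem symbolLaw_real_singleton_le (h : P ∈ expEnvelopeClass C α) (k : ℕ+) :
    (symbolLaw P).real {k} ≤ C * Real.exp (-α * (k : ℝ)) := by
  rw [symbolLaw, map_measureReal_apply (measurable_pi_apply 0) (measurableSet_singleton k)]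
  exact h.2 k

theorem measurePreserving_eval_marginal (h : IsStationaryMemoryless P) {n : ℕ} (i : Fin n) :
    MeasurePreserving (fun x : Fin n → ℕ+ => x i) (marginal P n) (symbolLaw P) := by
  have := isProbabilityMeasure_symbolLaw h
  rw [marginal_eq_pi h]
  exact measurePreserving_eval (fun _ : Fin n => symbolLaw P) i

end SymbolLaw

theorem integrable_of_summable_real_singleton {X : Type*} [MeasurableSpace X] [Countable X]
    [MeasurableSingletonClass X] {μ : Measure X} [IsFiniteMeasure μ] {f : X → ℝ}
    (h : Summable fun a => μ.real {a} * |f a|) : Integrable f μ := by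
  rw [← Measure.sum_smul_dirac μ]
  exact integrable_sum_dirac (fun a => measure_ne_top μ _) h

end ACCode
namespace ACCode

/-! ### Moments under an exponential envelope -/

section Moments

variable {C α : ℝ} {P : Measure (ℕ → ℕ+)}

/-- The first moment `∑ k C e ^ (-α k)` of the envelope. -/
noncomputable def envelopeMoment (C α : ℝ) : ℝ :=
  C * ∑' k : ℕ, (k : ℝ) * Real.exp (-α * k)

theorem envelopeMoment_nonneg (hC : 0 ≤ C) : 0 ≤ envelopeMoment C α :=
  mul_nonneg hC (tsum_nonneg fun k => by positivity)

/-- Truncated subtraction kills the terms k < K; shifting by K then factors out e^(-αK). -/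
theorem hasSum_envelope_excess (hα : 0 < α) (K : ℕ) :
    HasSum (fun k : ℕ => C * Real.exp (-α * k) * ((k - K : ℕ) : ℝ))
      (Real.exp (-α * K) * envelopeMoment C α) := by
  have h1 : Summable fun k : ℕ => (k : ℝ) * Real.exp (-α * k) := by
    simpa using Real.summable_pow_mul_exp_neg_nat_mul 1 hα
  have h2 := (h1.hasSum.mul_left C).mul_left (Real.exp (-α * K))
  rw [← hasSum_nat_add_iff' K, Finset.sum_eq_zero, sub_zero]
  · have e : (fun k : ℕ => C * Real.exp (-α * (k + K : ℕ)) * ((k + K - K : ℕ) : ℝ)) =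
        fun k : ℕ => Real.exp (-α * K) * (C * ((k : ℝ) * Real.exp (-α * k))) := by
      ext k
      rw [Nat.add_sub_cancel]
      push_cast
      rw [mul_add, Real.exp_add]
      ring
    rw [e]
    exact h2
  · intro k hk
    rw [Nat.sub_eq_zero_of_le (Finset.mem_range.1 hk).le]
    simp

theorem summable_symbolLaw_mul_excess (hα : 0 < α) (h : P ∈ expEnvelopeClass C α) (K : ℕ) :
    Summable fun k : ℕ+ => (symbolLaw P).real {k} * (((k : ℕ) - K : ℕ) : ℝ) :=
  Summable.of_nonneg_of_le (fun k => by positivity)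
    (fun k => mul_le_mul_of_nonneg_right (symbolLaw_real_singleton_le h k) (Nat.cast_nonneg _))
    ((hasSum_envelope_excess hα K).summable.comp_injective PNat.coe_injective)

theorem integrable_excess (hα : 0 < α) (h : P ∈ expEnvelopeClass C α) (K : ℕ) :
    Integrable (fun k : ℕ+ => (((k : ℕ) - K : ℕ) : ℝ)) (symbolLaw P) := by
  have := isProbabilityMeasure_symbolLaw h.1
  refine integrable_of_summable_real_singleton ?_
  simpa using summable_symbolLaw_mul_excess hα h K

theorem integral_excess_le (hα : 0 < α) (hC : 0 ≤ C) (h : P ∈ expEnvelopeClass C α) (K : ℕ) :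
    ∫ k : ℕ+, (((k : ℕ) - K : ℕ) : ℝ) ∂(symbolLaw P) ≤
      Real.exp (-α * K) * envelopeMoment C α := by
  have hs := hasSum_envelope_excess (C := C) hα K
  rw [integral_countable (integrable_excess hα h K), ← hs.tsum_eq]
  refine le_trans ?_ (tsum_comp_le_tsum_of_inj hs.summable (fun k => by positivity)
    PNat.coe_injective)
  exact (summable_symbolLaw_mul_excess hα h K).tsum_le_tsum
    (fun k => mul_le_mul_of_nonneg_right (symbolLaw_real_singleton_le h k) (Nat.cast_nonneg _))
    (hs.summable.comp_injective PNat.coe_injective)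

/-- The maximum exceeds a level K by no more than the total excess over K, which reduces its mean to
a one-symbol moment. -/
theorem runningMax_le {n : ℕ} (x : Fin n → ℕ+) (i K : ℕ) :
    runningMax x i ≤
      K + ∑ k ∈ Finset.univ.filter (fun k : Fin n => (k : ℕ) < i), ((x k : ℕ) - K) := by
  refine Finset.sup_le fun k hk => ?_
  have := Finset.single_le_sum (f := fun k : Fin n => (x k : ℕ) - K) (fun _ _ => Nat.zero_le _) hk
  omega

theorem cast_runningMax_le {n : ℕ} (x : Fin n → ℕ+) (i K : ℕ) :
    (runningMax x i : ℝ) ≤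
      K + ∑ k ∈ Finset.univ.filter (fun k : Fin n => (k : ℕ) < i), (((x k : ℕ) - K : ℕ) : ℝ) := by
  exact_mod_cast runningMax_le x i K

theorem isProbabilityMeasure_marginal (h : IsStationaryMemoryless P) (n : ℕ) :
    IsProbabilityMeasure (marginal P n) := by
  have := isProbabilityMeasure_symbolLaw h
  rw [marginal_eq_pi h]
  infer_instance

theorem integrable_sum_excess (hα : 0 < α) (h : P ∈ expEnvelopeClass C α) {n : ℕ} (i K : ℕ) :
    Integrable (fun x : Fin n → ℕ+ => (K : ℝ) +
      ∑ k ∈ Finset.univ.filter (fun k : Fin n => (k : ℕ) < i), (((x k : ℕ) - K : ℕ) : ℝ))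
      (marginal P n) := by
  have := isProbabilityMeasure_marginal h.1 n
  refine (integrable_const _).add (integrable_finsetSum _ fun k _ => ?_)
  exact (measurePreserving_eval_marginal h.1 k).integrable_comp_of_integrable
    (integrable_excess hα h K)

theorem integrable_runningMax (hα : 0 < α) (h : P ∈ expEnvelopeClass C α) (n i : ℕ) :
    Integrable (fun x : Fin n → ℕ+ => (runningMax x i : ℝ)) (marginal P n) := by
  refine (integrable_sum_excess hα h i 0).mono' Measurable.of_discrete.aestronglyMeasurable
    (.of_forall fun x => ?_)
  rw [Real.norm_of_nonneg (Nat.cast_nonneg _)]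
  exact cast_runningMax_le x i 0

theorem integral_runningMax_le_add (hα : 0 < α) (hC : 0 ≤ C) (h : P ∈ expEnvelopeClass C α)
    {n : ℕ} (i : Fin n) (K : ℕ) :
    ∫ x, (runningMax x i : ℝ) ∂(marginal P n) ≤
      K + (i : ℕ) * (Real.exp (-α * K) * envelopeMoment C α) := by
  have := isProbabilityMeasure_marginal h.1 n
  have hint : ∀ k : Fin n, Integrable (fun x : Fin n → ℕ+ => (((x k : ℕ) - K : ℕ) : ℝ))
      (marginal P n) := fun k =>
    (measurePreserving_eval_marginal h.1 k).integrable_comp_of_integrable (integrable_excess hα h K)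
  calc _ ≤ ∫ x : Fin n → ℕ+, ((K : ℝ) + ∑ k ∈ Finset.univ.filter
            (fun k : Fin n => (k : ℕ) < i), (((x k : ℕ) - K : ℕ) : ℝ)) ∂(marginal P n) :=
        integral_mono (integrable_runningMax hα h n i) (integrable_sum_excess hα h i K)
          fun x => cast_runningMax_le x i K
    _ = K + ∑ k ∈ Finset.univ.filter (fun k : Fin n => (k : ℕ) < i),
          ∫ y : ℕ+, (((y : ℕ) - K : ℕ) : ℝ) ∂(symbolLaw P) := by
        rw [integral_add (integrable_const _) (integrable_finsetSum _ fun k _ => hint k),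
          integral_finsetSum _ fun k _ => hint k]
        congr 1
        · simp
        · refine Finset.sum_congr rfl fun k _ => ?_
          rw [← (measurePreserving_eval_marginal h.1 k).map_eq, integral_map
            Measurable.of_discrete.aemeasurable Measurable.of_discrete.aestronglyMeasurable]
    _ ≤ _ := by
        rw [Finset.sum_const, nsmul_eq_mul]
        have hc : (Finset.univ.filter (fun k : Fin n => (k : ℕ) < i)).card = i := by
          rw [Fin.card_filter_val_lt, min_eq_right i.2.le]
        rw [hc]
        gcongr
        exact integral_excess_le hα hC h K

theorem integral_runningMax_le (hα : 0 < α) (hC : 0 ≤ C) (h : P ∈ expEnvelopeClass C α)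
    {n : ℕ} (i : Fin n) (hi : 0 < (i : ℕ)) :
    ∫ x, (runningMax x i : ℝ) ∂(marginal P n) ≤
      Real.log (i : ℕ) / α + 1 + envelopeMoment C α := by
  have hi1 : (1 : ℝ) ≤ (i : ℕ) := by exact_mod_cast hi
  have hlog := Real.log_nonneg hi1
  -- This level makes i e^(-αK) ≤ 1.
  have h1 := integral_runningMax_le_add hα hC h i ⌈Real.log (i : ℕ) / α⌉₊
  have h2 := (Nat.ceil_lt_add_one (div_nonneg hlog hα.le)).le
  have h3 : ((i : ℕ) : ℝ) * Real.exp (-α * ⌈Real.log (i : ℕ) / α⌉₊) ≤ 1 := by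
    have h4 := Nat.le_ceil (Real.log (i : ℕ) / α)
    rw [div_le_iff₀ hα] at h4
    nth_rw 1 [← Real.exp_log (by linarith : (0 : ℝ) < (i : ℕ))]
    rw [← Real.exp_add, Real.exp_le_one_iff]
    linarith
  have h5 := mul_le_mul_of_nonneg_right h3 (envelopeMoment_nonneg (α := α) hC)
  rw [← mul_assoc] at h1
  linarith

/-! ### Integrability of the code lengths -/

/-- Unlike p |log p|, √p is monotone, so the envelope can be inserted; its square root is still
summable. -/
theorem abs_log_mul_self_le_sqrt {p : ℝ} (h0 : 0 ≤ p) (h1 : p ≤ 1) :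
    p * |Real.log p| ≤ 2 * √p := by
  rcases h0.eq_or_lt with rfl | hp
  · simp
  · have h := Real.abs_log_mul_self_lt (√p) (Real.sqrt_pos.2 hp) (Real.sqrt_le_one.2 h1)
    rw [Real.log_sqrt hp.le, abs_mul, abs_div, abs_of_pos (Real.sqrt_pos.2 hp),
      abs_of_pos (two_pos : (0 : ℝ) < 2)] at h
    have hs := Real.mul_self_sqrt hp.le
    calc p * |Real.log p| = 2 * √p * (|Real.log p| / 2 * √p) := by
          nth_rw 1 [← hs]; ring
      _ ≤ 2 * √p * 1 := by gcongr
      _ = _ := mul_one _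

theorem integrable_log_symbolLaw (hα : 0 < α) (hC : 0 ≤ C) (h : P ∈ expEnvelopeClass C α) :
    Integrable (fun k : ℕ+ => Real.log ((symbolLaw P).real {k})) (symbolLaw P) := by
  have := isProbabilityMeasure_symbolLaw h.1
  refine integrable_of_summable_real_singleton ?_
  have hs : Summable fun k : ℕ => 2 * (√C * Real.exp (-(α / 2) * k)) := by
    simpa using ((Real.summable_pow_mul_exp_neg_nat_mul 0 (half_pos hα)).mul_left (√C)).mul_left 2
  refine Summable.of_nonneg_of_le (fun k => by positivity) (fun k => ?_)
    (hs.comp_injective PNat.coe_injective)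
  refine (abs_log_mul_self_le_sqrt measureReal_nonneg measureReal_le_one).trans ?_
  have h1 := Real.sqrt_le_sqrt (symbolLaw_real_singleton_le h k)
  rw [Real.sqrt_mul hC, ← Real.exp_half] at h1
  simp only [Function.comp_apply]
  have h2 : -α * ((k : ℕ) : ℝ) / 2 = -(α / 2) * ((k : ℕ) : ℝ) := by ring
  rw [h2] at h1
  linarith

/-- Discards the null strings, where log 0 = 0 would spoil the product rule and the likelihood
bound. -/
theorem ae_symbolLaw_pos (h : IsStationaryMemoryless P) (n : ℕ) :
    ∀ᵐ x ∂(marginal P n), ∀ i, 0 < (symbolLaw P).real {x i} := by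
  have := isProbabilityMeasure_symbolLaw h
  rw [ae_iff_of_countable]
  intro x hx i
  rw [marginal_eq_pi h, Measure.pi_singleton] at hx
  exact ENNReal.toReal_pos (Finset.prod_ne_zero_iff.1 hx i (Finset.mem_univ i)) (measure_ne_top _ _)

theorem ae_log_marginal_eq (h : IsStationaryMemoryless P) (n : ℕ) :
    (fun x => Real.log ((marginal P n).real {x})) =ᵐ[marginal P n]
      fun x => ∑ i, Real.log ((symbolLaw P).real {x i}) := by
  filter_upwards [ae_symbolLaw_pos h n] with x hx
  rw [marginal_real_singleton h, Real.log_prod fun i _ => (hx i).ne']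

theorem integrable_log_marginal (hα : 0 < α) (hC : 0 ≤ C) (h : P ∈ expEnvelopeClass C α) (n : ℕ) :
    Integrable (fun x => Real.log ((marginal P n).real {x})) (marginal P n) :=
  (integrable_finsetSum _ fun i _ =>
    (measurePreserving_eval_marginal h.1 i).integrable_comp_of_integrable
      (integrable_log_symbolLaw hα hC h)).congr (ae_log_marginal_eq h.1 n).symm

theorem integrable_log_codingProb (hα : 0 < α) (h : P ∈ expEnvelopeClass C α) (n : ℕ) :
    Integrable (fun x => Real.log (codingProb x)) (marginal P n) := by
  have := isProbabilityMeasure_marginal h.1 n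
  have hb : Integrable (fun x : Fin n → ℕ+ => ∑ i : Fin n, (2 * (i : ℝ) + runningMax x i))
      (marginal P n) := integrable_finsetSum _ fun i _ =>
    (integrable_const _).add (integrable_runningMax hα h n i)
  refine hb.mono' Measurable.of_discrete.aestronglyMeasurable (.of_forall fun x => ?_)
  rw [Real.norm_of_nonpos (log_codingProb_nonpos x)]
  exact neg_log_codingProb_le x

/-! ### The redundancy -/

theorem redundancy_mul_log_two (hα : 0 < α) (hC : 0 ≤ C) (h : P ∈ expEnvelopeClass C α) (n : ℕ) :
    redundancy P n * Real.log 2 =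
      ∫ x, (-Real.log (codingProb x) + Real.log ((marginal P n).real {x})) ∂(marginal P n) := by
  have := isProbabilityMeasure_marginal h.1 n
  have hq := integrable_log_codingProb hα h n
  have hl := integrable_log_marginal hα hC h n
  have h2 : Real.log 2 ≠ 0 := (Real.log_pos one_lt_two).ne'
  unfold redundancy entropy Real.logb
  have hq' : Integrable (fun x => -(Real.log (codingProb x) / Real.log 2)) (marginal P n) :=
    (hq.div_const _).neg
  have hq'' : Integrable (fun x => -Real.log (codingProb x)) (marginal P n) := hq.neg
  rw [integral_sub hq' (integrable_const _), integral_add hq'' hl,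
    integral_const, probReal_univ, one_smul, integral_neg, integral_neg, integral_neg,
    integral_div, integral_div]
  field_simp
  ring

theorem redundancy_mul_log_two_le (hα : 0 < α) (hC : 0 ≤ C) (h : P ∈ expEnvelopeClass C α)
    (n : ℕ) :
    redundancy P n * Real.log 2 ≤
      1 + ((Real.log n) ^ 2 + Real.log n) / (4 * α) +
        (2 + envelopeMoment C α) * Real.log n := by
  have := isProbabilityMeasure_marginal h.1 n
  have hν := isProbabilityMeasure_symbolLaw h.1
  have hint : ∀ i : Fin n, Integrable
      (fun x : Fin n → ℕ+ => ((runningMax x i : ℝ) + 1) / (2 * (i : ℕ))) (marginal P n) :=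
    fun i => ((integrable_runningMax hα h n i).add (integrable_const _)).div_const _
  set D := envelopeMoment C α with hD
  have hD0 : 0 ≤ D := envelopeMoment_nonneg hC
  have hterm : ∀ i : Fin n, ∫ x : Fin n → ℕ+, ((runningMax x i : ℝ) + 1) / (2 * (i : ℕ))
      ∂(marginal P n) ≤
      (Real.log (i : ℕ) / (i : ℕ)) * (1 / (2 * α)) + (1 / ((i : ℕ) : ℝ)) * ((2 + D) / 2) := by
    intro i
    rcases Nat.eq_zero_or_pos (i : ℕ) with hi | hi
    · simp [hi]
    · have hi' : (0 : ℝ) < (i : ℕ) := by exact_mod_cast hi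
      rw [integral_div, integral_add (integrable_runningMax hα h n i) (integrable_const _),
        integral_const, probReal_univ, one_smul, div_le_iff₀ (by positivity)]
      refine (add_le_add_left (integral_runningMax_le hα hC h i hi) 1).trans (le_of_eq ?_)
      rw [← hD]
      field_simp
      ring
  calc _ = _ := redundancy_mul_log_two hα hC h n
    _ ≤ ∫ x : Fin n → ℕ+, (1 + ∑ i : Fin n, ((runningMax x i : ℝ) + 1) / (2 * (i : ℕ)))
          ∂(marginal P n) := by
        refine integral_mono_ae
          ((integrable_log_codingProb hα h n).neg.add (integrable_log_marginal hα hC h n))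
          ((integrable_const _).add (integrable_finsetSum _ fun i _ => hint i)) ?_
        filter_upwards [ae_symbolLaw_pos h.1 n, ae_log_marginal_eq h.1 n] with x hx hx'
        simp only [hx']
        refine pathwise_redundancy_le x (fun k => (symbolLaw P).real {k}) hx fun s => ?_
        rw [sum_measureReal_singleton]
        exact measureReal_le_one
    _ = 1 + ∑ i : Fin n, ∫ x : Fin n → ℕ+, ((runningMax x i : ℝ) + 1) / (2 * (i : ℕ))
          ∂(marginal P n) := by
        rw [integral_add (integrable_const _) (integrable_finsetSum _ fun i _ => hint i),
          integral_finsetSum _ fun i _ => hint i]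
        simp
    _ ≤ 1 + ∑ i : Fin n, ((Real.log (i : ℕ) / (i : ℕ)) * (1 / (2 * α)) +
          (1 / ((i : ℕ) : ℝ)) * ((2 + D) / 2)) := by
        gcongr with i
        exact hterm i
    _ = 1 + ((∑ i ∈ Finset.range n, Real.log (i : ℝ) / i) * (1 / (2 * α)) +
          (∑ i ∈ Finset.range n, 1 / (i : ℝ)) * ((2 + D) / 2)) := by
        rw [Fin.sum_univ_eq_sum_range (fun i : ℕ => (Real.log (i : ℝ) / i) * (1 / (2 * α)) +
          (1 / (i : ℝ)) * ((2 + D) / 2)) n, Finset.sum_add_distrib, ← Finset.sum_mul,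
          ← Finset.sum_mul]
    _ ≤ 1 + (((Real.log n) ^ 2 + Real.log n) / 2 * (1 / (2 * α)) +
          2 * Real.log n * ((2 + D) / 2)) := by
        gcongr
        · exact sum_log_div_le n
        · exact sum_inv_le n
    _ = _ := by
        field_simp
        ring

end Moments

end ACCode

theorem mainTheorem4 (C α : ℝ) (hα : 0 < α) (hC : Real.exp (2 * α) < C) :
    (∀ n : ℕ, ∀ P ∈ ACCode.expEnvelopeClass C α,
      Integrable (fun x => Real.logb 2 ((ACCode.marginal P n).real {x})) (ACCode.marginal P n) ∧
      Integrable (fun x => Real.logb 2 (ACCode.codingProb x)) (ACCode.marginal P n)) ∧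
    (∀ n : ℕ, BddAbove (Set.range fun P : ACCode.expEnvelopeClass C α =>
      ACCode.redundancy P n)) ∧
    ∃ ε : ℕ → ℝ, Tendsto ε atTop (𝓝 0) ∧ ∀ᶠ n : ℕ in atTop,
      (⨆ P : ACCode.expEnvelopeClass C α, ACCode.redundancy P n) ≤
        (1 + ε n) * (1 / (4 * α * Real.logb 2 (Real.exp 1))) * (Real.logb 2 n) ^ 2 := by
  have hC0 : 0 ≤ C := ((Real.exp_pos _).trans hC).le
  have hl2 : 0 < Real.log 2 := Real.log_pos one_lt_two
  refine ⟨fun n P hP => ⟨(ACCode.integrable_log_marginal hα hC0 hP n).div_const _,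
    (ACCode.integrable_log_codingProb hα hP n).div_const _⟩, fun n => ?_, ?_⟩
  · refine ⟨(1 + ((Real.log n) ^ 2 + Real.log n) / (4 * α) +
      (2 + ACCode.envelopeMoment C α) * Real.log n) / Real.log 2, ?_⟩
    rintro _ ⟨P, rfl⟩
    exact (le_div_iff₀ hl2).2 (ACCode.redundancy_mul_log_two_le hα hC0 P.2 n)
  · set D := ACCode.envelopeMoment C α with hD
    have hD0 : 0 ≤ D := ACCode.envelopeMoment_nonneg hC0
    -- The lower-order terms of the redundancy bound divided by log² n / (4α).
    refine ⟨fun n => 4 * α * (Real.log n)⁻¹ ^ 2 +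
      (1 + 4 * α * (2 + D)) * (Real.log n)⁻¹, ?_, ?_⟩
    · have h : Tendsto (fun n : ℕ => (Real.log n)⁻¹) atTop (𝓝 0) :=
        (Real.tendsto_log_atTop.comp tendsto_natCast_atTop_atTop).inv_tendsto_atTop
      simpa using ((h.pow 2).const_mul (4 * α)).add (h.const_mul (1 + 4 * α * (2 + D)))
    · filter_upwards [eventually_ge_atTop 2] with n hn
      have hL : 0 < Real.log n := Real.log_pos (by exact_mod_cast hn)
      -- A real supremum over an empty family is 0, hence the second goal: the bound is nonnegative.
      refine Real.iSup_le (fun P => ?_) ?_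
      · have h := ACCode.redundancy_mul_log_two_le hα hC0 P.2 n
        rw [← hD, ← le_div_iff₀ hl2] at h
        refine h.trans (le_of_eq ?_)
        rw [Real.logb, Real.logb, Real.log_exp]
        field_simp
        ring
      · rw [Real.logb, Real.log_exp]
        positivity
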